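/- Let $\mathfrak g$ be a finite-dimensional semisimple Lie algebra over a field of characteristic zero (for instance $\mathbb R$), let $\mathfrak h$ be a splitting Cartan subalgebra, $\Delta\subset\mathfrak h^*$ the root system, $W(\Delta)$ its Weyl group. Two roots $\alpha,\gamma\in\Delta$ are called *strongly orthogonal* if $\alpha+\gamma\notin\Delta\cup\{0\}$ and $\alpha-\gamma\notin\Delta\cup\{0\}$. A set of roots is strongly orthogonal if any two distinct elements of it are strongly orthogonal, and it is a *maximum* set of strongly orthogonal roots if moreover no strongly orthogonal set of roots has larger cardinality. 1. Fix a base of $\Delta$, with positive roots $\Delta_+$. For a subsystem $\Delta'\subseteq\Delta$, the positive roots of $\Delta'$ are those of $\Delta'\cap\Delta_+$, and the highest root of an irreducible $\Delta'$ is the root $\beta\in\Delta'$ such that $\beta-\alpha$ is a sum of elements of $\Delta'\cap\Delta_+$ (possibly the empty sum) for every $\alpha\in\Delta'$. Let $(\Delta_i)_i$ be the irreducible components of $\Delta$, and let $\beta_i$ be the highest root of $\Delta_i$. Let $(\Delta_{ij})_j$ be the irreducible components of $\{\alpha\in\Delta_i : \alpha\perp\beta_i\}$, and let $\beta_{ij}$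 be the highest root of $\Delta_{ij}$; let $(\Delta_{ijk})_k$ be the irreducible components of $\{\alpha\in\Delta_{ij} : \alpha\perp\beta_{ij}\}$; and so on. Let $I(\Delta)=\{i,ij,ijk,\dots\}$ be the set of all indices that occur. Then every $\Delta_s$, $s\in I(\Delta)$, has a unique highest root $\beta_s$, different subsystems $\Delta_s$ have different highest roots, and $\{\beta_s : s\in I(\Delta)\}$ is a maximum set of strongly orthogonal roots of $\Delta$. 2. Any two maximum sets $\Gamma,\Gamma'$ of strongly orthogonal roots of $\Delta$ are conjugate under the Weyl group: there is $w\in W(\Delta)$ with $w(\Gamma)=\Gamma'$. -/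

import Mathlib

namespace RootPairing

variable {ι R M N : Type*} [CommRing R] [AddCommGroup M] [Module R M] [AddCommGroup N] [Module R N]

/-- Two roots are strongly orthogonal if neither their sum nor their difference lies in `Δ ∪ {0}`,
where `Δ` is the set of all roots. -/
def StronglyOrthogonal (P : RootPairing ι R M N) (i j : ι) : Prop :=
  P.root i + P.root j ∉ insert 0 (Set.range P.root) ∧
    P.root i - P.root j ∉ insert 0 (Set.range P.root)

/-- A set of roots is strongly orthogonal if any two distinct members are strongly orthogonal. -/
def IsStronglyOrthogonalSet (P : RootPairing ι R M N) (Γ : Set ι) : Prop :=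
  Γ.Pairwise P.StronglyOrthogonal

/-- A maximum set of strongly orthogonal roots: one of the largest possible cardinality. -/
def IsMaximumStronglyOrthogonalSet (P : RootPairing ι R M N) (Γ : Set ι) : Prop :=
  P.IsStronglyOrthogonalSet Γ ∧ ∀ Γ' : Set ι, P.IsStronglyOrthogonalSet Γ' → Γ'.encard ≤ Γ.encard

/-- A set of roots is irreducible if it is nonempty and is not the union of two nonempty,
mutually orthogonal subsets. -/
def IsIrreducibleSubset (P : RootPairing ι R M N) (Φ : Set ι) : Prop :=
  Φ.Nonempty ∧ ∀ A B : Set ι, A ∪ B = Φ → (∀ i ∈ A, ∀ j ∈ B, P.IsOrthogonal i j) → A = ∅ ∨ B = ∅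

/-- `Φ` is an irreducible component of the set of roots `Ψ`: it is an irreducible subset of `Ψ`,
orthogonal to the rest of `Ψ`. -/
def IsIrreducibleComponent (P : RootPairing ι R M N) (Ψ Φ : Set ι) : Prop :=
  Φ ⊆ Ψ ∧ P.IsIrreducibleSubset Φ ∧ ∀ i ∈ Φ, ∀ j ∈ Ψ \ Φ, P.IsOrthogonal i j

/-- The set of roots in `Φ` that are orthogonal to `β`. -/
def perpIn (P : RootPairing ι R M N) (Φ : Set ι) (β : ι) : Set ι :=
  {i ∈ Φ | P.IsOrthogonal i β}

section Cascade

variable [CharZero R] {P : RootPairing ι R M N}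

/-- `β` is the highest root of `Φ` with respect to the positive roots `Φ ∩ Δ₊`, where `Δ₊` is the
set of positive roots defined by the base `b`: it lies in `Φ`, and `β - α` is a sum of elements
of `Φ ∩ Δ₊` for every `α` in `Φ`. When `Φ` is a root subsystem these sums are the same as the sums
of simple roots of `Φ`. -/
def IsHighestRoot (b : P.Base) (Φ : Set ι) (β : ι) : Prop :=
  β ∈ Φ ∧ ∀ α ∈ Φ, P.root β - P.root α ∈ AddSubmonoid.closure (P.root '' {γ ∈ Φ | b.IsPos γ})

/-- The subsystems `Δ_i, Δ_ij, Δ_ijk, …` of the cascade: the irreducible components `Δ_i` of `Δ`,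
and, for every `Δ_s` already obtained, with highest root `β_s`, the irreducible components
of the set of roots of `Δ_s` orthogonal to `β_s`. -/
inductive IsCascadeSubsystem (b : P.Base) : Set ι → Prop
  | component (Φ : Set ι) (hΦ : P.IsIrreducibleComponent Set.univ Φ) : IsCascadeSubsystem b Φ
  | step (Φ Φ' : Set ι) (β : ι) (hΦ : IsCascadeSubsystem b Φ) (hβ : IsHighestRoot b Φ β)
      (hΦ' : P.IsIrreducibleComponent (P.perpIn Φ β) Φ') : IsCascadeSubsystem b Φ'

/-- The roots `β_s` produced by the cascade: the highest roots of the subsystems `Δ_s`. -/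
def cascadeRoots (b : P.Base) : Set ι :=
  {β | ∃ Φ : Set ι, IsCascadeSubsystem b Φ ∧ IsHighestRoot b Φ β}

end Cascade

end RootPairing

/-!
The cascade and the conjugacy statement both rest on a single exchange argument, which treats all
irreducible types at once. Lengths of roots are measured by the canonical invariant form
`rootInner`.

Let `Φ` be an irreducible closed subsystem. Any two of its roots have a common non-orthogonal root
(`IsIrreducibleSubset.exists_common_neighbor`), so its long roots form a single orbit under the
Weyl group of `Φ` (`IsLongIn.exists_weylPerm_eq`). A root orthogonal to a long root `β` is strongly
orthogonal to it, as their sum would be longer than `β`. Hence strongly orthogonal subsets of `Φ`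
containing `β` amount to strongly orthogonal subsets of `β^⊥ ∩ Φ`.

It remains to see that a maximum strongly orthogonal subset `Γ` of `Φ` contains a long root
(`IsStronglyOrthogonalSet.exists_ncard_lt`). Suppose it does not, let `α ∈ Γ`, and choose a long
root `γ` with `(γ, α) > 0`. If `α' ∈ Γ` were another member not orthogonal to `γ`, with
`(γ, α') > 0` after a change of sign, then `γ - α - α'` would have length at most zero, so that `γ = α + α'`,
contrary to strong orthogonality. So the remaining members are orthogonal to `γ`, and replacing `α`
by the pair `γ`, `γ - 2α` gives a larger strongly orthogonal set. Conjugacy follows by induction on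
the size of the subsystem (`IsMaximumIn.exists_weylPerm_image_eq`), with separate treatment of
orthogonal summands.

For the cascade, every root of `Φ` lies below a maximal one, and two maximal roots `μ`, `ν` are
equal: a positive root orthogonal to neither lies below some maximal `τ`, and dominance gives
`(τ, μ) > 0` and `(τ, ν) > 0`, whence `τ = μ` and `τ = ν` (`IsMaximalRoot.unique`). So `Φ` has a unique
highest root, and it is long (`IsHighestRoot.isLongIn`). The subsystems of the cascade form a
forest (`IsCascadeSubsystem.cascadeRel`), which gives strong orthogonality and injectivity of
`Φ ↦ β`, and the exchange argument gives the maximality by induction along the forest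
(`IsCascadeSubsystem.ncard_inter_le`).
-/

set_option linter.unusedSectionVars false

namespace RootPairing

section CanonicalForm

open Module

variable {ι K M N : Type*} [Fintype ι] [Field K] [CharZero K] [AddCommGroup M] [Module K M]
  [AddCommGroup N] [Module K N] (P : RootPairing ι K M N) [P.IsCrystallographic]

/-! ### The canonical form on roots -/

/-- The canonical Weyl-invariant form `(α, γ) = ∑ κ, ⟨α, κ^∨⟩ ⟨γ, κ^∨⟩` on pairs of roots. It is
integer valued, so that lengths of roots can be compared although `K` carries no order. -/
noncomputable def rootInner (i j : ι) : ℤ := ∑ k, P.pairingIn ℤ i k * P.pairingIn ℤ j k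

lemma cast_rootInner (i j : ι) : (P.rootInner i j : K) = P.RootForm (P.root i) (P.root j) := by
  have h (i j : ι) : ((P.pairingIn ℤ i j : ℤ) : K) = P.pairing i j := P.algebraMap_pairingIn ℤ i j
  simp [rootInner, rootForm_apply_apply, h]

lemma rootInner_comm (i j : ι) : P.rootInner i j = P.rootInner j i := by
  simp [rootInner, mul_comm]

lemma rootInner_self_pos (i : ι) : 0 < P.rootInner i i :=
  Finset.sum_pos' (fun k _ ↦ mul_self_nonneg _) ⟨i, Finset.mem_univ _, by simp⟩

lemma two_mul_rootInner (i j : ι) :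
    2 * P.rootInner i j = P.pairingIn ℤ i j * P.rootInner j j := by
  have h := congrArg (P.toLinearMap (P.root i)) (P.rootForm_self_smul_coroot j)
  have h' : ((P.pairingIn ℤ i j : ℤ) : K) = P.pairing i j := P.algebraMap_pairingIn ℤ i j
  rw [map_smul, map_nsmul, toLinearMap_apply_apply_Polarization, root_coroot_eq_pairing,
    ← cast_rootInner, ← cast_rootInner, ← h', smul_eq_mul, nsmul_eq_mul] at h
  have h2 : P.rootInner j j * P.pairingIn ℤ i j = 2 * P.rootInner j i := by exact_mod_cast h
  rw [P.rootInner_comm i j, ← h2, mul_comm]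

variable {P}

lemma rootInner_eq_of_root_eq {i j k : ι} {x y : ℤ} (h : P.root k = x • P.root i + y • P.root j)
    (l : ι) : P.rootInner k l = x * P.rootInner i l + y * P.rootInner j l := by
  have : (P.rootInner k l : K) = ((x * P.rootInner i l + y * P.rootInner j l : ℤ) : K) := by
    push_cast
    simp only [cast_rootInner, h, map_add, map_zsmul, LinearMap.add_apply, LinearMap.smul_apply,
      zsmul_eq_mul]
  exact_mod_cast this

lemma rootInner_add {i j k : ι} (h : P.root k = P.root i + P.root j) (l : ι) :
    P.rootInner k l = P.rootInner i l + P.rootInner j l := by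
  simpa using rootInner_eq_of_root_eq (x := 1) (y := 1) (by simpa using h) l

lemma rootInner_sub {i j k : ι} (h : P.root k = P.root i - P.root j) (l : ι) :
    P.rootInner k l = P.rootInner i l - P.rootInner j l := by
  simpa [sub_eq_add_neg] using
    rootInner_eq_of_root_eq (x := 1) (y := -1) (by simpa [sub_eq_add_neg] using h) l

lemma rootInner_sub_two_smul {i j k : ι} (h : P.root k = P.root i + (-2 : ℤ) • P.root j) (l : ι) :
    P.rootInner k l = P.rootInner i l - 2 * P.rootInner j l := by
  have := rootInner_eq_of_root_eq (x := 1) (y := -2) (h.trans (by rw [one_smul])) l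
  omega

lemma rootInner_neg {i j : ι} (h : P.root j = -P.root i) (l : ι) :
    P.rootInner j l = -P.rootInner i l := by
  simpa using rootInner_eq_of_root_eq (x := -1) (y := 0) (j := i) (by simpa using h) l

lemma pairingIn_pos_iff {i j : ι} : 0 < P.pairingIn ℤ i j ↔ 0 < P.rootInner i j := by
  have h := P.two_mul_rootInner i j
  have hj := P.rootInner_self_pos j
  constructor <;> intro h' <;> nlinarith

lemma pairingIn_neg_iff {i j : ι} : P.pairingIn ℤ i j < 0 ↔ P.rootInner i j < 0 := by
  have h := P.two_mul_rootInner i j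
  have hj := P.rootInner_self_pos j
  constructor <;> intro h' <;> nlinarith

lemma pairingIn_eq_zero_iff_rootInner {i j : ι} :
    P.pairingIn ℤ i j = 0 ↔ P.rootInner i j = 0 := by
  have h1 := pairingIn_pos_iff (P := P) (i := i) (j := j)
  have h2 := pairingIn_neg_iff (P := P) (i := i) (j := j)
  omega

lemma pairing_eq_zero_iff_rootInner {i j : ι} : P.pairing i j = 0 ↔ P.rootInner i j = 0 := by
  rw [← pairingIn_eq_zero_iff_rootInner, ← P.algebraMap_pairingIn ℤ i j]
  simp

lemma isOrthogonal_iff_rootInner {i j : ι} : P.IsOrthogonal i j ↔ P.rootInner i j = 0 := by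
  rw [IsOrthogonal, pairing_eq_zero_iff_rootInner, pairing_eq_zero_iff_rootInner,
    P.rootInner_comm j i, and_self]

lemma root_reflectionPerm_eq (i j : ι) :
    P.root (P.reflectionPerm i j) = P.root j + (-P.pairingIn ℤ j i) • P.root i := by
  have h' : ((P.pairingIn ℤ j i : ℤ) : K) = P.pairing j i := P.algebraMap_pairingIn ℤ j i
  rw [root_reflectionPerm, reflection_apply_root, ← h', Int.cast_smul_eq_zsmul, neg_smul,
    sub_eq_add_neg]

lemma rootInner_reflectionPerm (i j l : ι) : P.rootInner (P.reflectionPerm i j) l =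
    P.rootInner j l - P.pairingIn ℤ j i * P.rootInner i l := by
  have h := rootInner_eq_of_root_eq (P := P) (k := P.reflectionPerm i j) (i := j) (j := i) (x := 1)
    (y := -P.pairingIn ℤ j i) (by simpa using root_reflectionPerm_eq (P := P) i j) l
  linarith

lemma root_reflectionPerm_self (i : ι) : P.root (P.reflectionPerm i i) = -P.root i := by
  rw [root_reflectionPerm, reflection_apply_self]

lemma rootInner_neg_self (i l : ι) :
    P.rootInner (P.reflectionPerm i i) l = -P.rootInner i l :=
  rootInner_neg (root_reflectionPerm_self i) l

lemma reflectionPerm_of_rootInner_eq_zero {i j : ι} (h : P.rootInner i j = 0) :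
    P.reflectionPerm i j = j :=
  P.reflectionPerm_eq_of_pairing_eq_zero
    (pairing_eq_zero_iff_rootInner.2 (by rwa [rootInner_comm]))

lemma exists_root_eq_sub {i j : ι} (h : 0 < P.rootInner i j) (hij : i ≠ j) :
    ∃ k, P.root k = P.root i - P.root j :=
  P.root_sub_root_mem_of_pairingIn_pos (pairingIn_pos_iff.2 h) hij

lemma exists_root_eq_add {i j : ι} (h : P.rootInner i j < 0) (hij : P.root i ≠ -P.root j) :
    ∃ k, P.root k = P.root i + P.root j :=
  P.root_add_root_mem_of_pairingIn_neg (pairingIn_neg_iff.2 h) hij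

/-! ### Strong orthogonality -/

lemma StronglyOrthogonal.symm {i j : ι} (h : P.StronglyOrthogonal i j) :
    P.StronglyOrthogonal j i := by
  refine ⟨by rw [add_comm]; exact h.1, fun h' ↦ h.2 ?_⟩
  rw [← neg_sub]
  rcases h' with h' | ⟨k, hk⟩
  · exact Or.inl (by rw [h', neg_zero])
  · exact Or.inr ⟨P.reflectionPerm k k, by rw [root_reflectionPerm_self, hk]⟩

instance : Std.Symm P.StronglyOrthogonal := ⟨fun _ _ h ↦ h.symm⟩

lemma StronglyOrthogonal.ne {i j : ι} (h : P.StronglyOrthogonal i j) : i ≠ j := by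
  rintro rfl
  exact h.2 (Or.inl (sub_self _))

lemma StronglyOrthogonal.rootInner_eq_zero {i j : ι} (h : P.StronglyOrthogonal i j) :
    P.rootInner i j = 0 := by
  rcases lt_trichotomy (P.rootInner i j) 0 with h' | h' | h'
  · refine absurd (Or.inr ?_) h.1
    exact exists_root_eq_add h' fun h0 ↦ h.1 (Or.inl (by rw [h0, neg_add_cancel]))
  · exact h'
  · exact absurd (Or.inr (exists_root_eq_sub h' h.ne)) h.2

/-- For orthogonal roots `α` and `γ`, the reflection in `γ` exchanges `α + γ` and `α - γ`, so that
only one of them has to be considered. -/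
lemma stronglyOrthogonal_of_rootInner_eq_zero {i j : ι} (h : P.rootInner i j = 0)
    (hadd : ∀ k, P.root k ≠ P.root i + P.root j) : P.StronglyOrthogonal i j := by
  have hi := P.rootInner_self_pos i
  have hsub : ∀ k, P.root k ≠ P.root i - P.root j := by
    intro k hk
    refine hadd (P.reflectionPerm j k) ?_
    have : P.pairing i j = 0 := pairing_eq_zero_iff_rootInner.2 h
    rw [root_reflectionPerm, hk, map_sub, reflection_apply_self, reflection_apply_root, this]
    simp
  refine ⟨?_, ?_⟩
  · rintro (h0 | ⟨k, hk⟩)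
    · have := rootInner_neg (eq_neg_of_add_eq_zero_left h0) i
      rw [P.rootInner_comm j i] at this
      omega
    · exact hadd k hk
  · rintro (h0 | ⟨k, hk⟩)
    · rw [sub_eq_zero] at h0
      rw [P.root.injective h0] at h hi
      omega
    · exact hsub k hk

lemma StronglyOrthogonal.neg_right {i j : ι} (h : P.StronglyOrthogonal i j) :
    P.StronglyOrthogonal i (P.reflectionPerm j j) := by
  rw [StronglyOrthogonal, root_reflectionPerm_self, sub_neg_eq_add, ← sub_eq_add_neg]
  exact ⟨h.2, h.1⟩

end CanonicalForm

section Subsystems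

open Module

variable {ι K M N : Type*} [Fintype ι] [Field K] [CharZero K] [AddCommGroup M] [Module K M]
  [AddCommGroup N] [Module K N] {P : RootPairing ι K M N} [P.IsCrystallographic]

/-! ### Closed subsystems and their Weyl groups -/

variable (P) in
/-- A set of roots is a closed subsystem if it is stable under its own reflections (in particular
under negation) and contains every root that is a sum of two of its members. -/
structure IsClosedSubsystem (Φ : Set ι) : Prop where
  reflectionPerm_mem : ∀ {i j : ι}, i ∈ Φ → j ∈ Φ → P.reflectionPerm i j ∈ Φ
  add_mem : ∀ {i j k : ι}, i ∈ Φ → j ∈ Φ → P.root k = P.root i + P.root j → k ∈ Φ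

lemma isClosedSubsystem_univ : P.IsClosedSubsystem Set.univ :=
  ⟨fun _ _ ↦ trivial, fun _ _ _ ↦ trivial⟩

lemma IsClosedSubsystem.sub_mem {Φ : Set ι} (hΦ : P.IsClosedSubsystem Φ) {i j k : ι} (hi : i ∈ Φ)
    (hj : j ∈ Φ) (hk : P.root k = P.root i - P.root j) : k ∈ Φ :=
  hΦ.add_mem hi (hΦ.reflectionPerm_mem hj hj)
    (by rw [hk, root_reflectionPerm_self, sub_eq_add_neg])

/-- An orthogonal summand of a closed subsystem is a closed subsystem. -/
lemma IsClosedSubsystem.of_orthogonal_diff {Ψ A : Set ι} (hΨ : P.IsClosedSubsystem Ψ) (hA : A ⊆ Ψ)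
    (h : ∀ i ∈ A, ∀ j ∈ Ψ \ A, P.IsOrthogonal i j) : P.IsClosedSubsystem A := by
  simp only [isOrthogonal_iff_rootInner] at h
  refine ⟨fun {i j} hi hj ↦ ?_, fun {i j k} hi hj hk ↦ ?_⟩
  · by_contra hc
    have hk := hΨ.reflectionPerm_mem (hA hi) (hA hj)
    have h1 := h i hi _ ⟨hk, hc⟩
    have h2 : P.rootInner i j = 0 := by
      rw [rootInner_comm, rootInner_reflectionPerm] at h1
      have h3 := P.two_mul_rootInner j i
      rw [P.rootInner_comm]
      linarith
    rw [reflectionPerm_of_rootInner_eq_zero h2] at hc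
    exact hc hj
  · by_contra hc
    have hk' := hΨ.add_mem (hA hi) (hA hj) hk
    have h1 := h i hi k ⟨hk', hc⟩
    have h2 := h j hj k ⟨hk', hc⟩
    have h3 := rootInner_add hk k
    have := P.rootInner_self_pos k
    omega

/-- A root `α + γ` with `α ∈ A` and `γ` in the orthogonal complement of `A` is orthogonal to neither
of the two, hence belongs to neither of the two parts. -/
lemma IsClosedSubsystem.stronglyOrthogonal_of_orthogonal_diff {Ψ A : Set ι}
    (hΨ : P.IsClosedSubsystem Ψ) (hA : A ⊆ Ψ) (h : ∀ i ∈ A, ∀ j ∈ Ψ \ A, P.IsOrthogonal i j)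
    {i j : ι} (hi : i ∈ A) (hj : j ∈ Ψ \ A) : P.StronglyOrthogonal i j := by
  simp only [isOrthogonal_iff_rootInner] at h
  have hij := h i hi j hj
  refine stronglyOrthogonal_of_rootInner_eq_zero hij fun k hk ↦ ?_
  have h1 := rootInner_add hk i
  have h2 := rootInner_add hk j
  have h3 := P.rootInner_self_pos i
  have h4 := P.rootInner_self_pos j
  rw [P.rootInner_comm j i] at h1
  by_cases hkA : k ∈ A
  · have := h k hkA j hj
    omega
  · have := h i hi k ⟨hΨ.add_mem (hA hi) hj.1 hk, hkA⟩
    rw [P.rootInner_comm] at this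
    omega

lemma mem_perpIn {Φ : Set ι} {β i : ι} : i ∈ P.perpIn Φ β ↔ i ∈ Φ ∧ P.rootInner i β = 0 := by
  rw [perpIn, Set.mem_ofPred_eq, isOrthogonal_iff_rootInner]

lemma perpIn_subset {Φ : Set ι} {β : ι} : P.perpIn Φ β ⊆ Φ := fun _ h ↦ h.1

lemma notMem_perpIn {Φ : Set ι} {β : ι} : β ∉ P.perpIn Φ β := fun h ↦
  (P.rootInner_self_pos β).ne' (mem_perpIn.1 h).2

lemma IsClosedSubsystem.perpIn {Φ : Set ι} (hΦ : P.IsClosedSubsystem Φ) (β : ι) :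
    P.IsClosedSubsystem (P.perpIn Φ β) := by
  refine ⟨fun {i j} hi hj ↦ ?_, fun {i j k} hi hj hk ↦ ?_⟩
  all_goals
    rw [mem_perpIn] at hi hj ⊢
  · refine ⟨hΦ.reflectionPerm_mem hi.1 hj.1, ?_⟩
    rw [rootInner_reflectionPerm, hi.2, hj.2, mul_zero, sub_zero]
  · refine ⟨hΦ.add_mem hi.1 hj.1 hk, ?_⟩
    rw [rootInner_add hk, hi.2, hj.2, add_zero]

variable (P) in
/-- The group of permutations of the roots generated by the reflections in the roots of `Φ`. -/
def weylPerm (Φ : Set ι) : Subgroup (Equiv.Perm ι) := Subgroup.closure (P.reflectionPerm '' Φ)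

lemma reflectionPerm_mem_weylPerm {Φ : Set ι} {i : ι} (hi : i ∈ Φ) :
    P.reflectionPerm i ∈ P.weylPerm Φ :=
  Subgroup.subset_closure ⟨i, hi, rfl⟩

lemma weylPerm_mono {Φ Ψ : Set ι} (h : Φ ⊆ Ψ) : P.weylPerm Φ ≤ P.weylPerm Ψ :=
  Subgroup.closure_mono (Set.image_mono h)

lemma exists_linearEquiv_of_mem_weylPerm {Φ : Set ι} {g : Equiv.Perm ι} (hg : g ∈ P.weylPerm Φ) :
    ∃ e : M ≃ₗ[K] M, ∀ i, P.root (g i) = e (P.root i) := by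
  induction hg using Subgroup.closure_induction with
  | mem x hx =>
    obtain ⟨j, -, rfl⟩ := hx
    exact ⟨P.reflection j, fun i ↦ P.root_reflectionPerm j i⟩
  | one => exact ⟨LinearEquiv.refl K M, fun i ↦ rfl⟩
  | mul x y _ _ hx hy =>
    obtain ⟨e, he⟩ := hx
    obtain ⟨f, hf⟩ := hy
    exact ⟨f.trans e, fun i ↦ by simp [he, hf]⟩
  | inv x _ hx =>
    obtain ⟨e, he⟩ := hx
    refine ⟨e.symm, fun i ↦ ?_⟩
    rw [LinearEquiv.eq_symm_apply, ← he, Equiv.Perm.inv_def, Equiv.apply_symm_apply]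

lemma rootInner_weylPerm {Φ : Set ι} {g : Equiv.Perm ι} (hg : g ∈ P.weylPerm Φ) (i j : ι) :
    P.rootInner (g i) (g j) = P.rootInner i j := by
  induction hg using Subgroup.closure_induction generalizing i j with
  | mem x hx =>
    obtain ⟨k, -, rfl⟩ := hx
    have : (P.rootInner (P.reflectionPerm k i) (P.reflectionPerm k j) : K) = P.rootInner i j := by
      rw [cast_rootInner, cast_rootInner, root_reflectionPerm, root_reflectionPerm,
        rootForm_reflection_reflection_apply]
    exact_mod_cast this
  | one => rfl
  | mul x y _ _ hx hy => rw [Equiv.Perm.mul_apply, Equiv.Perm.mul_apply, hx, hy]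
  | inv x _ hx =>
    rw [← hx]
    simp only [Equiv.Perm.inv_def, Equiv.apply_symm_apply]

lemma IsClosedSubsystem.weylPerm_apply_mem {Φ : Set ι} (hΦ : P.IsClosedSubsystem Φ)
    {g : Equiv.Perm ι} (hg : g ∈ P.weylPerm Φ) {i : ι} : g i ∈ Φ ↔ i ∈ Φ := by
  induction hg using Subgroup.closure_induction generalizing i with
  | mem x hx =>
    obtain ⟨k, hk, rfl⟩ := hx
    refine ⟨fun h ↦ ?_, fun h ↦ hΦ.reflectionPerm_mem hk h⟩
    simpa using hΦ.reflectionPerm_mem hk h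
  | one => rfl
  | mul x y _ _ hx hy => rw [Equiv.Perm.mul_apply, hx, hy]
  | inv x _ hx => rw [← hx, Equiv.Perm.inv_def, Equiv.apply_symm_apply]

lemma weylPerm_apply_of_orthogonal {Φ : Set ι} {g : Equiv.Perm ι} (hg : g ∈ P.weylPerm Φ) {i : ι}
    (hi : ∀ j ∈ Φ, P.rootInner j i = 0) : g i = i := by
  induction hg using Subgroup.closure_induction with
  | mem x hx =>
    obtain ⟨k, hk, rfl⟩ := hx
    exact reflectionPerm_of_rootInner_eq_zero (hi k hk)
  | one => rfl
  | mul x y _ _ hx hy => rw [Equiv.Perm.mul_apply, hy, hx]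
  | inv x _ hx => rw [Equiv.Perm.inv_eq_iff_eq, hx]

lemma StronglyOrthogonal.weylPerm {Φ : Set ι} {g : Equiv.Perm ι} (hg : g ∈ P.weylPerm Φ) {i j : ι}
    (h : P.StronglyOrthogonal i j) : P.StronglyOrthogonal (g i) (g j) := by
  obtain ⟨e, he⟩ := exists_linearEquiv_of_mem_weylPerm hg
  have key (x : M) (hx : x ∉ insert 0 (Set.range P.root)) :
      e x ∉ insert 0 (Set.range P.root) := by
    rintro (h0 | ⟨k, hk⟩)
    · exact hx (Or.inl (by simpa using h0))
    · refine hx (Or.inr ⟨g⁻¹ k, e.injective ?_⟩)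
      rw [← he, Equiv.Perm.inv_def, Equiv.apply_symm_apply, hk]
  rw [StronglyOrthogonal, he, he, ← map_add, ← map_sub]
  exact ⟨key _ h.1, key _ h.2⟩

lemma IsStronglyOrthogonalSet.image {Φ Γ : Set ι} {g : Equiv.Perm ι} (hg : g ∈ P.weylPerm Φ)
    (h : P.IsStronglyOrthogonalSet Γ) : P.IsStronglyOrthogonalSet (g '' Γ) := by
  rintro _ ⟨i, hi, rfl⟩ _ ⟨j, hj, rfl⟩ hij
  exact (h hi hj fun h' ↦ hij (by rw [h'])).weylPerm hg

/-! ### Irreducible subsystems and long roots -/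

/-- Any two roots `i` and `j` of an irreducible closed subsystem `Φ` have a common non-orthogonal
root. Indeed the roots in the span of the neighbours of `i` form an orthogonal summand of `Φ`, hence
all of `Φ`; so `j` lies in this span and cannot be orthogonal to all neighbours of `i`. -/
lemma IsIrreducibleSubset.exists_common_neighbor {Φ : Set ι} (hΦ : P.IsClosedSubsystem Φ)
    (hirr : P.IsIrreducibleSubset Φ) {i j : ι} (hi : i ∈ Φ) (hj : j ∈ Φ) :
    ∃ k ∈ Φ, P.rootInner k i ≠ 0 ∧ P.rootInner k j ≠ 0 := by
  by_contra! hcon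
  let S : Submodule K M := Submodule.span K (P.root '' {k ∈ Φ | P.rootInner k i ≠ 0})
  -- a root orthogonal to all neighbours of `i` pairs to zero with their span
  have hperp (l : ι) (hl : ∀ k ∈ Φ, P.rootInner k i ≠ 0 → P.rootInner k l = 0) (x : M)
      (hx : x ∈ S) : P.coroot' l x = 0 := by
    have : S ≤ LinearMap.ker (P.coroot' l) := by
      rw [Submodule.span_le]
      rintro _ ⟨k, ⟨hk, hki⟩, rfl⟩
      rw [SetLike.mem_coe, LinearMap.mem_ker, root_coroot'_eq_pairing,
        pairing_eq_zero_iff_rootInner]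
      exact hl k hk hki
    exact this hx
  have hnot (l : ι) (hl : l ∈ Φ) (hlS : P.root l ∉ S) (k : ι) (hk : k ∈ Φ)
      (hki : P.rootInner k i ≠ 0) : P.rootInner k l = 0 := by
    have hli : P.rootInner l i = 0 := by
      by_contra h
      exact hlS (Submodule.subset_span ⟨l, ⟨hl, h⟩, rfl⟩)
    by_contra h
    have hk' : P.root (P.reflectionPerm l k) ∈ S := by
      refine Submodule.subset_span ⟨_, ⟨hΦ.reflectionPerm_mem hl hk, ?_⟩, rfl⟩
      rwa [rootInner_reflectionPerm, hli, mul_zero, sub_zero]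
    have hkS : P.root k ∈ S := Submodule.subset_span ⟨k, ⟨hk, hki⟩, rfl⟩
    rw [root_reflectionPerm, reflection_apply_root] at hk'
    refine hlS ((Submodule.smul_mem_iff S
      (mt pairing_eq_zero_iff_rootInner.1 h)).1 ?_)
    simpa using S.sub_mem hkS hk'
  have hsplit := hirr.2 {l ∈ Φ | P.root l ∈ S} {l ∈ Φ | P.root l ∉ S}
    (by ext l; simp only [Set.mem_union, Set.mem_ofPred_eq]; tauto) (by
      rintro k ⟨hk, hkS⟩ l ⟨hl, hlS⟩
      have := hperp l (hnot l hl hlS) _ hkS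
      rw [root_coroot'_eq_pairing, pairing_eq_zero_iff_rootInner] at this
      exact isOrthogonal_iff_rootInner.2 this)
  have hiS : P.root i ∈ S :=
    Submodule.subset_span ⟨i, ⟨hi, (P.rootInner_self_pos i).ne'⟩, rfl⟩
  rcases hsplit with h | h
  · exact Set.notMem_empty i (h ▸ ⟨hi, hiS⟩)
  · have hjS : P.root j ∈ S := by
      by_contra hc
      exact Set.notMem_empty j (h ▸ ⟨hj, hc⟩)
    have := hperp j hcon _ hjS
    rw [root_coroot'_eq_pairing, pairing_same] at this
    exact two_ne_zero this

lemma IsIrreducibleSubset.exists_weylPerm_rootInner_pos {Φ : Set ι} (hΦ : P.IsClosedSubsystem Φ)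
    (hirr : P.IsIrreducibleSubset Φ) {i j : ι} (hi : i ∈ Φ) (hj : j ∈ Φ) :
    ∃ g ∈ P.weylPerm Φ, 0 < P.rootInner (g i) j := by
  suffices ∃ g ∈ P.weylPerm Φ, P.rootInner (g i) j ≠ 0 by
    obtain ⟨g, hg, h⟩ := this
    rcases h.lt_or_gt with h | h
    · refine ⟨P.reflectionPerm (g i) * g, mul_mem (reflectionPerm_mem_weylPerm
        ((hΦ.weylPerm_apply_mem hg).2 hi)) hg, ?_⟩
      rw [Equiv.Perm.mul_apply, rootInner_neg_self]
      omega
    · exact ⟨g, hg, h⟩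
  by_cases hij : P.rootInner i j = 0
  · obtain ⟨k, hk, hki, hkj⟩ := hirr.exists_common_neighbor hΦ hi hj
    refine ⟨P.reflectionPerm k, reflectionPerm_mem_weylPerm hk, ?_⟩
    rw [rootInner_reflectionPerm, hij, zero_sub, neg_ne_zero]
    refine mul_ne_zero (fun h ↦ hki ?_) hkj
    rwa [P.rootInner_comm, ← pairingIn_eq_zero_iff_rootInner]
  · exact ⟨1, one_mem _, hij⟩

variable (P) in
/-- `β` is a root of `Φ` of maximal length among the roots of `Φ`. -/
def IsLongIn (Φ : Set ι) (β : ι) : Prop :=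
  β ∈ Φ ∧ ∀ i ∈ Φ, P.rootInner i i ≤ P.rootInner β β

lemma exists_isLongIn {Φ : Set ι} (h : Φ.Nonempty) : ∃ β, P.IsLongIn Φ β := by
  obtain ⟨β, hβ, h⟩ := Set.exists_max_image Φ (fun i ↦ P.rootInner i i) (Set.toFinite Φ) h
  exact ⟨β, hβ, h⟩

lemma IsLongIn.weylPerm_apply {Φ : Set ι} (hΦ : P.IsClosedSubsystem Φ) {β : ι}
    (hβ : P.IsLongIn Φ β) {g : Equiv.Perm ι} (hg : g ∈ P.weylPerm Φ) : P.IsLongIn Φ (g β) :=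
  ⟨(hΦ.weylPerm_apply_mem hg).2 hβ.1, fun i hi ↦ by
    rw [rootInner_weylPerm hg]; exact hβ.2 i hi⟩

/-- If `α + β` were a root, it would be longer than `β`. -/
lemma IsLongIn.stronglyOrthogonal {Φ : Set ι} (hΦ : P.IsClosedSubsystem Φ) {β : ι}
    (hβ : P.IsLongIn Φ β) {i : ι} (hi : i ∈ P.perpIn Φ β) : P.StronglyOrthogonal i β := by
  rw [mem_perpIn] at hi
  refine stronglyOrthogonal_of_rootInner_eq_zero hi.2 fun k hk ↦ ?_
  have h1 := hβ.2 k (hΦ.add_mem hi.1 hβ.1 hk)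
  have h2 := rootInner_add hk k
  have h3 := rootInner_add hk i
  have h4 := rootInner_add hk β
  have h5 := P.rootInner_self_pos i
  rw [P.rootInner_comm i k, P.rootInner_comm β k] at h2
  rw [P.rootInner_comm β i] at h3
  omega

end Subsystems

section Reduced

open Module

variable {ι K M N : Type*} [Fintype ι] [Field K] [CharZero K] [AddCommGroup M] [Module K M]
  [AddCommGroup N] [Module K N] {P : RootPairing ι K M N} [P.IsCrystallographic] [P.IsReduced]

/-! ### Exchanging short roots for long ones -/

lemma IsLongIn.exists_weylPerm_eq {Φ : Set ι} (hΦ : P.IsClosedSubsystem Φ)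
    (hirr : P.IsIrreducibleSubset Φ) {γ β : ι} (hγ : P.IsLongIn Φ γ) (hβ : P.IsLongIn Φ β) :
    ∃ g ∈ P.weylPerm Φ, g γ = β := by
  obtain ⟨g, hg, hpos⟩ := hirr.exists_weylPerm_rootInner_pos hΦ hγ.1 hβ.1
  by_cases hne : g γ = β
  · exact ⟨g, hg, hne⟩
  have hgγ := hγ.weylPerm_apply hΦ hg
  generalize hga : g γ = a at *
  have hlen : P.rootInner a a = P.rootInner β β :=
    le_antisymm (hβ.2 _ hgγ.1) (hgγ.2 _ hβ.1)
  -- equal lengths and a positive product force both pairings to be one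
  have hp : 2 * P.rootInner a β = P.rootInner β β := by
    have h1 := P.two_mul_rootInner a β
    have h2 := P.two_mul_rootInner β a
    rw [P.rootInner_comm β a] at h2
    have hβ0 := P.rootInner_self_pos β
    have h3 : P.pairingIn ℤ a β = P.pairingIn ℤ β a := by
      rw [h1, hlen] at h2
      exact mul_right_cancel₀ hβ0.ne' h2
    have h4 := pairingIn_pos_iff.2 hpos
    have h5 := P.pairingIn_pairingIn_mem_set_of_isCrystal_of_isRed a β
    have h6 := P.pairingIn_two_two_iff ℤ a β
    simp only [Set.mem_insert_iff, Set.mem_singleton_iff, Prod.mk.injEq] at h5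
    have h7 : P.pairingIn ℤ a β = 1 := by
      by_contra h
      exact hne (h6.1 (by omega))
    rw [h1, h7, one_mul]
  -- the reflection in `δ = a - β` exchanges `a` and `β`
  obtain ⟨δ, hδ⟩ := exists_root_eq_sub hpos hne
  have hδΦ := hΦ.sub_mem hgγ.1 hβ.1 hδ
  refine ⟨P.reflectionPerm δ * g, mul_mem (reflectionPerm_mem_weylPerm hδΦ) hg, ?_⟩
  have hp' : P.pairingIn ℤ a δ = 1 := by
    have d1 := rootInner_sub hδ δ
    have d2 := rootInner_sub hδ a
    have d3 := rootInner_sub hδ β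
    have h1 := P.two_mul_rootInner a δ
    have hδ0 := P.rootInner_self_pos δ
    rw [P.rootInner_comm a δ] at d1 h1
    rw [P.rootInner_comm β δ] at d1
    rw [P.rootInner_comm β a] at d2
    refine mul_right_cancel₀ hδ0.ne' ?_
    rw [← h1]
    omega
  refine P.root.injective ?_
  rw [Equiv.Perm.mul_apply, hga, root_reflectionPerm_eq, hp', hδ, neg_smul, one_smul]
  abel

/-- A long root `γ` and a shorter root `α` with `(γ, α) > 0` satisfy `⟨α, γ^∨⟩ = 1`, and the squared
length of `γ` is two or three times that of `α`. -/
lemma IsLongIn.rootInner_of_not_isLongIn {Φ : Set ι} {γ i : ι} (hγ : P.IsLongIn Φ γ) (hi : i ∈ Φ)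
    (hi' : ¬ P.IsLongIn Φ i) (hpos : 0 < P.rootInner γ i) :
    2 * P.rootInner γ i = P.rootInner γ γ ∧
      (P.rootInner γ γ = 2 * P.rootInner i i ∨ P.rootInner γ γ = 3 * P.rootInner i i) := by
  have hlt : P.rootInner i i < P.rootInner γ γ := by
    refine lt_of_le_of_ne (hγ.2 i hi) fun h ↦ hi' ⟨hi, fun k hk ↦ ?_⟩
    rw [h]
    exact hγ.2 k hk
  have h1 := P.two_mul_rootInner γ i
  have h2 := P.two_mul_rootInner i γ
  rw [P.rootInner_comm i γ] at h2
  have h3 := pairingIn_pos_iff.2 hpos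
  have h5 := P.pairingIn_pairingIn_mem_set_of_isCrystal_of_isRed γ i
  have h6 := P.rootInner_self_pos i
  simp only [Set.mem_insert_iff, Set.mem_singleton_iff, Prod.mk.injEq] at h5
  rcases h5 with h | h | h | h | h | h | h | h | h | h | h | h | h <;>
    rw [h.1] at h1 h3 <;> rw [h.2] at h2 <;> constructor <;> omega

/-- A long root is non-orthogonal to at most one of two strongly orthogonal shorter roots `α`, `α'`:
otherwise, after a change of sign, `γ - α - α'` would have non-positive length, so that
`γ = α + α'`. -/
lemma IsLongIn.rootInner_eq_zero_of_stronglyOrthogonal {Φ : Set ι} (hΦ : P.IsClosedSubsystem Φ)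
    {γ i j : ι} (hγ : P.IsLongIn Φ γ) (hi : i ∈ Φ) (hj : j ∈ Φ) (hi' : ¬ P.IsLongIn Φ i)
    (hj' : ¬ P.IsLongIn Φ j) (hij : P.StronglyOrthogonal i j) (hpos : 0 < P.rootInner γ i) :
    P.rootInner γ j = 0 := by
  have key (j : ι) (hj : j ∈ Φ) (hj' : ¬ P.IsLongIn Φ j) (hij : P.StronglyOrthogonal i j) :
      P.rootInner γ j ≤ 0 := by
    by_contra! hposj
    obtain ⟨h1, h2⟩ := hγ.rootInner_of_not_isLongIn hi hi' hpos
    obtain ⟨h3, h4⟩ := hγ.rootInner_of_not_isLongIn hj hj' hposj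
    have hij0 := hij.rootInner_eq_zero
    obtain ⟨δ, hδ⟩ := exists_root_eq_sub hpos (by rintro rfl; exact hi' hγ)
    have hδj := rootInner_sub hδ j
    obtain ⟨ε, hε⟩ := exists_root_eq_sub (i := δ) (j := j) (by rw [hδj, hij0]; omega) (by
      rintro rfl
      exact hij.1 (Or.inr ⟨γ, by rw [hδ]; abel⟩))
    have e1 := rootInner_sub hε ε
    have e2 := rootInner_sub hε δ
    have e3 := rootInner_sub hε j
    have d1 := rootInner_sub hδ δ
    have d2 := rootInner_sub hδ γ
    have d3 := rootInner_sub hδ i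
    have hε0 := P.rootInner_self_pos ε
    simp only [P.rootInner_comm δ ε, P.rootInner_comm j ε, P.rootInner_comm γ δ,
      P.rootInner_comm i δ, P.rootInner_comm i γ, P.rootInner_comm j δ] at *
    omega
  have h1 := key j hj hj' hij
  have h2 := key (P.reflectionPerm j j) (hΦ.reflectionPerm_mem hj hj) (fun h ↦ hj' (by
    simpa using h.weylPerm_apply hΦ (reflectionPerm_mem_weylPerm hj))) hij.neg_right
  rw [P.rootInner_comm, rootInner_neg_self, P.rootInner_comm] at h2
  omega

lemma IsLongIn.exists_root_eq_sub_two_smul {Φ : Set ι} (hΦ : P.IsClosedSubsystem Φ) {γ i : ι}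
    (hγ : P.IsLongIn Φ γ) (hi : i ∈ Φ) (hi' : ¬ P.IsLongIn Φ i) (hpos : 0 < P.rootInner γ i) :
    ∃ η ∈ Φ, P.root η = P.root γ + (-2 : ℤ) • P.root i := by
  obtain ⟨h1, h2⟩ := hγ.rootInner_of_not_isLongIn hi hi' hpos
  have hi0 := P.rootInner_self_pos i
  rcases h2 with h2 | h2
  · refine ⟨P.reflectionPerm i γ, hΦ.reflectionPerm_mem hi hγ.1, ?_⟩
    have h3 := P.two_mul_rootInner γ i
    have : P.pairingIn ℤ γ i = 2 := by
      rw [h1, h2] at h3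
      exact (mul_right_cancel₀ hi0.ne' h3).symm
    rw [root_reflectionPerm_eq, this]
  -- here the root string `γ, γ - α, γ - 2α, γ - 3α` has four terms
  · obtain ⟨δ, hδ⟩ := exists_root_eq_sub hpos (by rintro rfl; exact hi' hγ)
    have hδi := rootInner_sub hδ i
    obtain ⟨η, hη⟩ := exists_root_eq_sub (i := δ) (j := i) (by rw [hδi]; omega) (by
      rintro rfl
      omega)
    refine ⟨η, hΦ.sub_mem (hΦ.sub_mem hγ.1 hi hδ) hi hη, ?_⟩
    rw [hη, hδ, neg_smul, two_smul]
    abel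

/-- The root `η = γ - 2α` replacing `α` is strongly orthogonal to every root that is orthogonal to
both `α` and `γ`. -/
lemma IsLongIn.stronglyOrthogonal_sub_two_smul {Φ : Set ι} (hΦ : P.IsClosedSubsystem Φ)
    {γ i j η : ι} (hγ : P.IsLongIn Φ γ) (hi : i ∈ Φ) (hi' : ¬ P.IsLongIn Φ i)
    (hpos : 0 < P.rootInner γ i) (hηΦ : η ∈ Φ)
    (hη : P.root η = P.root γ + (-2 : ℤ) • P.root i) (hj : j ∈ Φ) (hji : P.rootInner j i = 0)
    (hjγ : P.rootInner j γ = 0) : P.StronglyOrthogonal j η := by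
  obtain ⟨h1, h2⟩ := hγ.rootInner_of_not_isLongIn hi hi' hpos
  have he (l : ι) : P.rootInner η l = P.rootInner γ l - 2 * P.rootInner i l :=
    rootInner_sub_two_smul hη l
  have h3 := he j
  rw [P.rootInner_comm γ j, P.rootInner_comm i j, hji, hjγ] at h3
  refine stronglyOrthogonal_of_rootInner_eq_zero (by rw [rootInner_comm, h3]; rfl) fun θ hθ ↦ ?_
  have t (l : ι) := rootInner_add hθ l
  have t1 := t θ
  have t2 := t j
  have t3 := t η
  have t4 := t i
  have e1 := he η
  have e2 := he γ
  have e3 := he i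
  have hj0 := P.rootInner_self_pos j
  have hi0 := P.rootInner_self_pos i
  simp only [P.rootInner_comm j θ, P.rootInner_comm η θ, P.rootInner_comm j η, P.rootInner_comm γ η,
    P.rootInner_comm i η, P.rootInner_comm i γ] at *
  rcases h2 with h2 | h2
  -- `(γ, γ) = 2 (α, α)`: here `η` is long, so `θ` would be longer than `γ`
  · have := hγ.2 θ (hΦ.add_mem hj hηΦ hθ)
    omega
  -- `(γ, γ) = 3 (α, α)`: here `η` and `α` have equal length, and `⟨α, θ^∨⟩` would lie strictly
  -- between `-1` and `0`
  · have h5 := P.two_mul_rootInner i θ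
    rw [P.rootInner_comm i θ] at h5
    rcases le_or_gt 0 (P.pairingIn ℤ i θ) with h | h
    · nlinarith
    · nlinarith

/-- The exchange step: a strongly orthogonal set without long roots is never of maximum size. For a
long root `γ` not orthogonal to a member `α`, all other members are orthogonal to `γ`, and `α` can
be replaced by the two roots `γ` and `γ - 2α`. -/
lemma IsStronglyOrthogonalSet.exists_ncard_lt {Φ : Set ι} (hΦ : P.IsClosedSubsystem Φ)
    (hirr : P.IsIrreducibleSubset Φ) {Γ : Set ι} (hΓΦ : Γ ⊆ Φ) (hΓ : P.IsStronglyOrthogonalSet Γ)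
    (hshort : ∀ i ∈ Γ, ¬ P.IsLongIn Φ i) :
    ∃ Γ' ⊆ Φ, P.IsStronglyOrthogonalSet Γ' ∧ Γ.ncard < Γ'.ncard ∧ ∃ i ∈ Γ', P.IsLongIn Φ i := by
  obtain ⟨β, hβ⟩ := exists_isLongIn (P := P) hirr.1
  rcases Γ.eq_empty_or_nonempty with rfl | ⟨i, hi⟩
  · exact ⟨{β}, by simpa using hβ.1, Set.pairwise_singleton _ _, by simp, β, rfl, hβ⟩
  obtain ⟨g, hg, hpos⟩ := hirr.exists_weylPerm_rootInner_pos hΦ hβ.1 (hΓΦ hi)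
  have hγ := hβ.weylPerm_apply hΦ hg
  generalize g β = γ at *
  obtain ⟨η, hηΦ, hη⟩ := hγ.exists_root_eq_sub_two_smul hΦ (hΓΦ hi) (hshort i hi) hpos
  have hγj (j : ι) (hj : j ∈ Γ \ {i}) : P.rootInner γ j = 0 :=
    hγ.rootInner_eq_zero_of_stronglyOrthogonal hΦ (hΓΦ hi) (hΓΦ hj.1) (hshort i hi)
      (hshort j hj.1) (hΓ hi hj.1 (Ne.symm hj.2)) hpos
  have hjγ (j : ι) (hj : j ∈ Γ \ {i}) : P.StronglyOrthogonal j γ :=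
    hγ.stronglyOrthogonal hΦ (mem_perpIn.2 ⟨hΓΦ hj.1, by rw [rootInner_comm, hγj j hj]⟩)
  have hjη (j : ι) (hj : j ∈ Γ \ {i}) : P.StronglyOrthogonal j η :=
    hγ.stronglyOrthogonal_sub_two_smul hΦ (hΓΦ hi) (hshort i hi) hpos hηΦ hη (hΓΦ hj.1)
      (hΓ hj.1 hi hj.2).rootInner_eq_zero (hjγ j hj).rootInner_eq_zero
  have hηγ : P.StronglyOrthogonal η γ := by
    refine hγ.stronglyOrthogonal hΦ (mem_perpIn.2 ⟨hηΦ, ?_⟩)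
    have h1 := rootInner_sub_two_smul hη γ
    have h2 := (hγ.rootInner_of_not_isLongIn (hΓΦ hi) (hshort i hi) hpos).1
    rw [P.rootInner_comm i γ] at h1
    omega
  refine ⟨insert γ (insert η (Γ \ {i})), ?_, ?_, ?_, γ, Set.mem_insert _ _, hγ⟩
  · exact Set.insert_subset hγ.1 (Set.insert_subset hηΦ (Set.sdiff_subset.trans hΓΦ))
  · refine Set.pairwise_insert_of_symm.2
      ⟨Set.pairwise_insert_of_symm.2 ⟨hΓ.mono Set.sdiff_subset, ?_⟩, ?_⟩
    · exact fun j hj _ ↦ (hjη j hj).symm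
    · rintro j (rfl | hj) _
      · exact hηγ.symm
      · exact (hjγ j hj).symm
  · rw [Set.ncard_insert_of_notMem, Set.ncard_insert_of_notMem]
    · have := Set.ncard_sdiff_singleton_add_one hi
      omega
    · exact fun h ↦ (hjη η h).ne rfl
    · rintro (h | h)
      · exact hηγ.ne h.symm
      · exact (hjγ γ h).ne rfl

/-! ### Maximum strongly orthogonal subsets -/

variable (P) in
/-- `Γ` is a strongly orthogonal subset of `Φ` of maximum cardinality. -/
def IsMaximumIn (Φ Γ : Set ι) : Prop :=
  Γ ⊆ Φ ∧ P.IsStronglyOrthogonalSet Γ ∧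
    ∀ Γ' ⊆ Φ, P.IsStronglyOrthogonalSet Γ' → Γ'.ncard ≤ Γ.ncard

lemma exists_isMaximumIn (Φ : Set ι) : ∃ Γ, P.IsMaximumIn Φ Γ := by
  obtain ⟨Γ, hΓ, h⟩ := Set.exists_max_image {Γ | Γ ⊆ Φ ∧ P.IsStronglyOrthogonalSet Γ} Set.ncard
    (Set.toFinite _) ⟨∅, Set.empty_subset _, Set.pairwise_empty _⟩
  exact ⟨Γ, hΓ.1, hΓ.2, fun Γ' h1 h2 ↦ h Γ' ⟨h1, h2⟩⟩

lemma IsMaximumIn.image {Φ Γ : Set ι} (hΦ : P.IsClosedSubsystem Φ) (h : P.IsMaximumIn Φ Γ)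
    {g : Equiv.Perm ι} (hg : g ∈ P.weylPerm Φ) : P.IsMaximumIn Φ (g '' Γ) := by
  refine ⟨?_, h.2.1.image hg, fun Γ' h1 h2 ↦ ?_⟩
  · rintro _ ⟨i, hi, rfl⟩
    exact (hΦ.weylPerm_apply_mem hg).2 (h.1 hi)
  · rw [Set.ncard_image_of_injective _ g.injective]
    exact h.2.2 Γ' h1 h2

lemma IsMaximumIn.exists_weylPerm_mem_image {Φ Γ : Set ι} (hΦ : P.IsClosedSubsystem Φ)
    (hirr : P.IsIrreducibleSubset Φ) (h : P.IsMaximumIn Φ Γ) {β : ι} (hβ : P.IsLongIn Φ β) :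
    ∃ g ∈ P.weylPerm Φ, β ∈ g '' Γ := by
  by_cases hlong : ∀ i ∈ Γ, ¬ P.IsLongIn Φ i
  · obtain ⟨Γ', h1, h2, h3, -⟩ := h.2.1.exists_ncard_lt hΦ hirr h.1 hlong
    exact absurd (h.2.2 Γ' h1 h2) (by omega)
  · push Not at hlong
    obtain ⟨i, hi, hi'⟩ := hlong
    obtain ⟨g, hg, rfl⟩ := hi'.exists_weylPerm_eq hΦ hirr hβ
    exact ⟨g, hg, i, hi, rfl⟩

/-- If `Γ` is a maximum strongly orthogonal subset of `Φ` containing a long root `β`, then the rest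
of `Γ` is one of `β^⊥ ∩ Φ`. -/
lemma IsMaximumIn.diff_singleton {Φ Γ : Set ι} (hΦ : P.IsClosedSubsystem Φ)
    (h : P.IsMaximumIn Φ Γ) {β : ι} (hβ : P.IsLongIn Φ β) (hβΓ : β ∈ Γ) :
    P.IsMaximumIn (P.perpIn Φ β) (Γ \ {β}) := by
  refine ⟨fun i hi ↦ mem_perpIn.2 ⟨h.1 hi.1, (h.2.1 hi.1 hβΓ hi.2).rootInner_eq_zero⟩,
    h.2.1.mono Set.sdiff_subset, fun Γ' h1 h2 ↦ ?_⟩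
  have h3 := h.2.2 (insert β Γ') (Set.insert_subset hβ.1 (h1.trans perpIn_subset))
    (Set.pairwise_insert_of_symm.2
      ⟨h2, fun i hi _ ↦ (hβ.stronglyOrthogonal hΦ (h1 hi)).symm⟩)
  rw [Set.ncard_insert_of_notMem fun h ↦ notMem_perpIn (h1 h)] at h3
  have := Set.ncard_sdiff_singleton_add_one hβΓ
  omega

lemma IsMaximumIn.inter {Ψ Γ A : Set ι} (hΨ : P.IsClosedSubsystem Ψ) (hA : A ⊆ Ψ)
    (horth : ∀ i ∈ A, ∀ j ∈ Ψ \ A, P.IsOrthogonal i j) (h : P.IsMaximumIn Ψ Γ) :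
    P.IsMaximumIn A (Γ ∩ A) := by
  refine ⟨Set.inter_subset_right, h.2.1.mono Set.inter_subset_left, fun Γ' h1 h2 ↦ ?_⟩
  have h3 := h.2.2 (Γ' ∪ Γ \ A) (Set.union_subset (h1.trans hA) (Set.sdiff_subset.trans h.1))
    (Set.pairwise_union_of_symm.2
      ⟨h2, h.2.1.mono Set.sdiff_subset, fun i hi j hj _ ↦
        hΨ.stronglyOrthogonal_of_orthogonal_diff hA horth (h1 hi) ⟨h.1 hj.1, hj.2⟩⟩)
  rw [Set.ncard_union_eq (Set.disjoint_left.2 fun i hi hi' ↦ hi'.2 (h1 hi))] at h3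
  have := Set.ncard_inter_add_ncard_sdiff_eq_ncard Γ A
  omega

/-- A nonempty reducible set of roots is the union of two nonempty orthogonal parts, the second of
which is expressed as a set difference. -/
lemma exists_orthogonal_diff {Ψ : Set ι} (hne : Ψ.Nonempty) (hirr : ¬ P.IsIrreducibleSubset Ψ) :
    ∃ A ⊆ Ψ, A.Nonempty ∧ (Ψ \ A).Nonempty ∧ ∀ i ∈ A, ∀ j ∈ Ψ \ A, P.IsOrthogonal i j := by
  rw [IsIrreducibleSubset, not_and] at hirr
  have := hirr hne
  push Not at this
  obtain ⟨A, B, rfl, horth, hA, hB⟩ := this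
  have hdiff : (A ∪ B) \ A = B := by
    ext i
    refine ⟨fun h ↦ h.1.resolve_left h.2, fun h ↦ ⟨Or.inr h, fun h' ↦ ?_⟩⟩
    exact (P.rootInner_self_pos i).ne' (isOrthogonal_iff_rootInner.1 (horth i h' i h))
  exact ⟨A, Set.subset_union_left, hA, by rwa [hdiff], by rwa [hdiff]⟩

/-- Maximum strongly orthogonal subsets of a closed subsystem are conjugate: after moving a long
root `β` into both sets, one passes to the roots orthogonal to `β`. -/
theorem IsMaximumIn.exists_weylPerm_image_eq {Ψ Γ Γ' : Set ι} (hΨ : P.IsClosedSubsystem Ψ)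
    (h : P.IsMaximumIn Ψ Γ) (h' : P.IsMaximumIn Ψ Γ') : ∃ g ∈ P.weylPerm Ψ, g '' Γ = Γ' := by
  induction hn : Ψ.ncard using Nat.strong_induction_on generalizing Ψ Γ Γ' with
  | _ n ih =>
  subst hn
  rcases Ψ.eq_empty_or_nonempty with rfl | hne
  · refine ⟨1, one_mem _, ?_⟩
    rw [Set.subset_empty_iff.1 h.1, Set.subset_empty_iff.1 h'.1, Set.image_empty]
  by_cases hirr : P.IsIrreducibleSubset Ψ
  · obtain ⟨β, hβ⟩ := exists_isLongIn (P := P) hne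
    obtain ⟨g, hg, hgβ⟩ := h.exists_weylPerm_mem_image hΨ hirr hβ
    obtain ⟨g', hg', hgβ'⟩ := h'.exists_weylPerm_mem_image hΨ hirr hβ
    have hlt : P.perpIn Ψ β ⊂ Ψ :=
      ⟨perpIn_subset, fun hs ↦ notMem_perpIn (P := P) (hs hβ.1)⟩
    obtain ⟨k, hk, hkeq⟩ := ih _ (Set.ncard_lt_ncard hlt) (hΨ.perpIn β)
      ((h.image hΨ hg).diff_singleton hΨ hβ hgβ) ((h'.image hΨ hg').diff_singleton hΨ hβ hgβ') rfl
    have hkβ : k β = β := weylPerm_apply_of_orthogonal hk fun j hj ↦ (mem_perpIn.1 hj).2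
    have hkg : k '' (g '' Γ) = g' '' Γ' := by
      rw [← Set.insert_sdiff_self_of_mem hgβ, Set.image_insert_eq, hkeq, hkβ,
        Set.insert_sdiff_self_of_mem hgβ']
    refine ⟨g'⁻¹ * (k * g), mul_mem (inv_mem hg') (mul_mem (weylPerm_mono perpIn_subset hk) hg), ?_⟩
    rw [Equiv.Perm.coe_mul, Set.image_comp, Equiv.Perm.coe_mul, Set.image_comp, hkg,
      ← Set.image_comp, ← Equiv.Perm.coe_mul, inv_mul_cancel, Equiv.Perm.coe_one, Set.image_id]
  · obtain ⟨A, hA, ⟨a, ha⟩, ⟨b, hb⟩, horth⟩ := exists_orthogonal_diff hne hirr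
    have horth' : ∀ i ∈ Ψ \ A, ∀ j ∈ Ψ \ (Ψ \ A), P.IsOrthogonal i j := by
      rw [Set.sdiff_sdiff_cancel_left hA]
      exact fun i hi j hj ↦ (horth j hj i hi).symm
    have hB : Ψ \ A ⊆ Ψ := Set.sdiff_subset
    obtain ⟨g₁, hg₁, he₁⟩ := ih _ (Set.ncard_lt_ncard ⟨hA, fun hs ↦ hb.2 (hs hb.1)⟩)
      (hΨ.of_orthogonal_diff hA horth) (h.inter hΨ hA horth) (h'.inter hΨ hA horth) rfl
    obtain ⟨g₂, hg₂, he₂⟩ := ih _ (Set.ncard_lt_ncard ⟨hB, fun hs ↦ (hs (hA ha)).2 ha⟩)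
      (hΨ.of_orthogonal_diff hB horth') (h.inter hΨ hB horth') (h'.inter hΨ hB horth') rfl
    have hfix₁ (i : ι) (hi : i ∈ Ψ \ A) : g₁ i = i := weylPerm_apply_of_orthogonal hg₁
      fun j hj ↦ isOrthogonal_iff_rootInner.1 (horth j hj i hi)
    have hfix₂ (i : ι) (hi : i ∈ A) : g₂ i = i := weylPerm_apply_of_orthogonal hg₂
      fun j hj ↦ isOrthogonal_iff_rootInner.1 (horth i hi j hj).symm
    have hsplit (Δ : Set ι) (hΔ : Δ ⊆ Ψ) : Δ ∩ A ∪ Δ ∩ (Ψ \ A) = Δ := by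
      rw [← Set.inter_union_distrib_left, Set.union_sdiff_cancel hA, Set.inter_eq_left.2 hΔ]
    refine ⟨g₁ * g₂, mul_mem (weylPerm_mono hA hg₁) (weylPerm_mono hB hg₂), ?_⟩
    rw [← hsplit Γ h.1, ← hsplit Γ' h'.1, Set.image_union, Equiv.Perm.coe_mul, Set.image_comp,
      Set.image_comp, he₂, ← he₁]
    congr 1
    · congr 1
      exact (Set.image_congr fun i hi ↦ hfix₂ i hi.2).trans (Set.image_id' _)
    · exact (Set.image_congr fun i hi ↦ hfix₁ i hi.2).trans (Set.image_id' _)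

/-! ### Highest roots -/

lemma Base.isPos_of_root_mem_closure {b : P.Base} {i : ι}
    (h : P.root i ∈ AddSubmonoid.closure (P.root '' b.support)) : b.IsPos i := by
  obtain ⟨f, hf⟩ : ∃ f : ι → ℕ, P.root i = ∑ j ∈ b.support, f j • P.root j := by
    generalize P.root i = x at h
    induction h using AddSubmonoid.closure_induction with
    | mem x hx =>
      obtain ⟨k, hk, rfl⟩ := hx
      classical
      exact ⟨Pi.single k 1, by simp [Pi.single_apply, ite_smul, Finset.mem_coe.1 hk]⟩
    | zero => exact ⟨0, by simp⟩
    | add x y _ _ hx hy =>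
      obtain ⟨f, rfl⟩ := hx
      obtain ⟨g, rfl⟩ := hy
      exact ⟨f + g, by simp [add_smul, Finset.sum_add_distrib]⟩
  rw [isPos_iff', b.height_eq_sum (f := fun j ↦ (f j : ℤ)) (by simpa using hf)]
  exact Finset.sum_nonneg fun _ _ ↦ Int.natCast_nonneg _

lemma Base.height_of_root_eq_neg (b : P.Base) {i j : ι} (h : P.root j = -P.root i) :
    b.height j = -b.height i := by
  have : j = P.reflectionPerm i i := P.root.injective (by rw [h, root_reflectionPerm_self])
  rw [this]
  exact b.height_reflectionPerm_self i

lemma Base.isPos_of_root_mem_closure_isPos {b : P.Base} {Φ : Set ι} {i : ι}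
    (h : P.root i ∈ AddSubmonoid.closure (P.root '' {γ ∈ Φ | b.IsPos γ})) : b.IsPos i := by
  refine isPos_of_root_mem_closure (AddSubmonoid.closure_le.2 ?_ h)
  rintro _ ⟨j, ⟨-, hj⟩, rfl⟩
  refine (b.root_mem_or_neg_mem j).resolve_right fun hn ↦ ?_
  rw [← root_reflectionPerm_self] at hn
  have h1 := isPos_of_root_mem_closure hn
  rw [isPos_iff] at h1 hj
  rw [b.height_of_root_eq_neg (root_reflectionPerm_self j)] at h1
  omega

/-- A positive root `μ` of `Φ` such that `μ + γ` is not a root for any positive root `γ` of `Φ`. -/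
structure IsMaximalRoot (b : P.Base) (Φ : Set ι) (μ : ι) : Prop where
  mem : μ ∈ Φ
  isPos : b.IsPos μ
  root_ne_add : ∀ γ ∈ Φ, b.IsPos γ → ∀ k, P.root k ≠ P.root μ + P.root γ

variable {b : P.Base} {Φ : Set ι}

/-- Every root of `Φ` lies below a maximal one, namely below one of greatest height. -/
lemma exists_isMaximalRoot_sub_mem (hΦ : P.IsClosedSubsystem Φ) {i : ι} (hi : i ∈ Φ) :
    ∃ μ, IsMaximalRoot b Φ μ ∧
      P.root μ - P.root i ∈ AddSubmonoid.closure (P.root '' {γ ∈ Φ | b.IsPos γ}) := by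
  obtain ⟨μ, ⟨hμ, hμi⟩, hmax⟩ := Set.exists_max_image
    {κ ∈ Φ | P.root κ - P.root i ∈ AddSubmonoid.closure (P.root '' {γ ∈ Φ | b.IsPos γ})}
    b.height (Set.toFinite _) ⟨i, hi, by rw [sub_self]; exact zero_mem _⟩
  refine ⟨μ, ⟨hμ, ?_, fun γ hγ hpos k hk ↦ ?_⟩, hμi⟩
  · refine (Base.IsPos.or_neg b μ).resolve_right fun hneg ↦ ?_
    change b.IsPos (P.reflectionPerm μ μ) at hneg
    have hmem := hΦ.reflectionPerm_mem hμ hμ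
    have hgen : -P.root μ ∈ AddSubmonoid.closure (P.root '' {γ ∈ Φ | b.IsPos γ}) :=
      AddSubmonoid.subset_closure ⟨_, ⟨hmem, hneg⟩, root_reflectionPerm_self μ⟩
    have h1 := hmax (P.reflectionPerm μ μ) ⟨hmem, by
      -- `-μ - i = 2 (-μ) + (μ - i)`
      have := add_mem (add_mem hgen hgen) hμi
      rw [root_reflectionPerm_self]
      convert this using 1
      abel⟩
    have h2 := b.height_of_root_eq_neg (root_reflectionPerm_self (P := P) μ)
    rw [Base.isPos_iff] at hneg
    omega
  · have h1 := hmax k ⟨hΦ.add_mem hμ hγ hk, by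
      have := add_mem hμi (AddSubmonoid.subset_closure (s := P.root '' {γ ∈ Φ | b.IsPos γ})
        ⟨γ, ⟨hγ, hpos⟩, rfl⟩)
      rw [hk]
      convert this using 1
      abel⟩
    have h2 := b.height_add hk
    rw [Base.isPos_iff] at hpos
    omega

/-- Maximal roots are dominant. -/
lemma IsMaximalRoot.rootInner_nonneg {μ : ι} (hμ : IsMaximalRoot b Φ μ) :
    ∀ γ ∈ Φ, b.IsPos γ → 0 ≤ P.rootInner γ μ := by
  intro γ hγ hpos
  by_contra! hlt
  rw [rootInner_comm] at hlt
  obtain ⟨k, hk⟩ := exists_root_eq_add hlt (fun h ↦ by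
    have h1 := b.height_of_root_eq_neg h
    have h2 := hμ.isPos
    rw [Base.isPos_iff] at h2 hpos
    omega)
  exact hμ.root_ne_add γ hγ hpos k hk

/-- Pairing with a dominant root is monotone for the order defined by the positive roots of `Φ`. -/
lemma rootInner_le_of_sub_mem_closure {μ i j : ι}
    (hμ : ∀ γ ∈ Φ, b.IsPos γ → 0 ≤ P.rootInner γ μ)
    (h : P.root i - P.root j ∈ AddSubmonoid.closure (P.root '' {γ ∈ Φ | b.IsPos γ})) :
    P.rootInner j μ ≤ P.rootInner i μ := by
  obtain ⟨n, hn⟩ : ∃ n : ℕ, P.RootForm (P.root i - P.root j) (P.root μ) = n := by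
    generalize P.root i - P.root j = x at h
    induction h using AddSubmonoid.closure_induction with
    | mem x hx =>
      obtain ⟨k, ⟨hk, hpos⟩, rfl⟩ := hx
      obtain ⟨n, hn⟩ := Int.eq_ofNat_of_zero_le (hμ k hk hpos)
      exact ⟨n, by rw [← cast_rootInner, hn, Int.cast_natCast]⟩
    | zero => exact ⟨0, by simp⟩
    | add x y _ _ hx hy =>
      obtain ⟨m, hm⟩ := hx
      obtain ⟨n, hn⟩ := hy
      exact ⟨m + n, by rw [map_add, LinearMap.add_apply, hm, hn, Nat.cast_add]⟩
  rw [map_sub, LinearMap.sub_apply, ← cast_rootInner, ← cast_rootInner] at hn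
  have : P.rootInner i μ - P.rootInner j μ = n := by exact_mod_cast hn
  omega

lemma IsMaximalRoot.eq_of_rootInner_pos (hΦ : P.IsClosedSubsystem Φ) {μ ν : ι}
    (hμ : IsMaximalRoot b Φ μ) (hν : IsMaximalRoot b Φ ν) (h : 0 < P.rootInner μ ν) : μ = ν := by
  by_contra hne
  obtain ⟨k, hk⟩ := exists_root_eq_sub h hne
  have hkΦ := hΦ.sub_mem hμ.mem hν.mem hk
  rcases Base.IsPos.or_neg b k with hpos | hneg
  · exact hν.root_ne_add k hkΦ hpos μ (by rw [hk]; abel)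
  · exact hμ.root_ne_add (P.reflectionPerm k k) (hΦ.reflectionPerm_mem hkΦ hkΦ) hneg ν
      (by rw [root_reflectionPerm_self, hk]; abel)

/-- In an irreducible subsystem there is only one maximal root: a positive root that is orthogonal
to neither of two maximal roots lies below a third one, which equals both. -/
lemma IsMaximalRoot.unique (hΦ : P.IsClosedSubsystem Φ) (hirr : P.IsIrreducibleSubset Φ) {μ ν : ι}
    (hμ : IsMaximalRoot b Φ μ) (hν : IsMaximalRoot b Φ ν) : μ = ν := by
  obtain ⟨k, hk, hkμ, hkν, hpos⟩ :
      ∃ k ∈ Φ, P.rootInner k μ ≠ 0 ∧ P.rootInner k ν ≠ 0 ∧ b.IsPos k := by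
    obtain ⟨k, hk, hkμ, hkν⟩ := hirr.exists_common_neighbor hΦ hμ.mem hν.mem
    rcases Base.IsPos.or_neg b k with hpos | hneg
    · exact ⟨k, hk, hkμ, hkν, hpos⟩
    · exact ⟨P.reflectionPerm k k, hΦ.reflectionPerm_mem hk hk,
        by rwa [rootInner_neg_self, neg_ne_zero], by rwa [rootInner_neg_self, neg_ne_zero], hneg⟩
  obtain ⟨τ, hτ, hτk⟩ := exists_isMaximalRoot_sub_mem (b := b) hΦ hk
  have key {κ : ι} (hκ : IsMaximalRoot b Φ κ) (hkκ : P.rootInner k κ ≠ 0) : τ = κ := by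
    refine hτ.eq_of_rootInner_pos hΦ hκ ?_
    have h1 := rootInner_le_of_sub_mem_closure hκ.rootInner_nonneg hτk
    have h2 := hκ.rootInner_nonneg k hk hpos
    omega
  rw [← key hμ hkμ, ← key hν hkν]

lemma IsMaximalRoot.isHighestRoot (hΦ : P.IsClosedSubsystem Φ) (hirr : P.IsIrreducibleSubset Φ)
    {μ : ι} (hμ : IsMaximalRoot b Φ μ) : IsHighestRoot b Φ μ := by
  refine ⟨hμ.mem, fun i hi ↦ ?_⟩
  obtain ⟨ν, hν, hνi⟩ := exists_isMaximalRoot_sub_mem (b := b) hΦ hi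
  rwa [hμ.unique hΦ hirr hν]

lemma IsHighestRoot.eq_of_isMaximalRoot (hΦ : P.IsClosedSubsystem Φ) {β μ : ι}
    (hβ : IsHighestRoot b Φ β) (hμ : IsMaximalRoot b Φ μ) : β = μ := by
  by_contra hne
  have hsub := hβ.2 μ hμ.mem
  have h1 := rootInner_le_of_sub_mem_closure hμ.rootInner_nonneg hsub
  have h2 := P.rootInner_self_pos μ
  obtain ⟨k, hk⟩ := exists_root_eq_sub (h2.trans_le h1) hne
  rw [← hk] at hsub
  exact hμ.root_ne_add k (hΦ.sub_mem hβ.1 hμ.mem hk) (Base.isPos_of_root_mem_closure_isPos hsub) β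
    (by rw [hk]; abel)

lemma existsUnique_isHighestRoot (hΦ : P.IsClosedSubsystem Φ) (hirr : P.IsIrreducibleSubset Φ) :
    ∃! β, IsHighestRoot b Φ β := by
  obtain ⟨i, hi⟩ := hirr.1
  obtain ⟨μ, hμ, -⟩ := exists_isMaximalRoot_sub_mem (b := b) hΦ hi
  exact ⟨μ, hμ.isHighestRoot hΦ hirr, fun β hβ ↦ hβ.eq_of_isMaximalRoot hΦ hμ⟩

lemma IsHighestRoot.isMaximalRoot (hΦ : P.IsClosedSubsystem Φ) {β : ι}
    (hβ : IsHighestRoot b Φ β) : IsMaximalRoot b Φ β := by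
  obtain ⟨μ, hμ, -⟩ := exists_isMaximalRoot_sub_mem (b := b) hΦ hβ.1
  rwa [hβ.eq_of_isMaximalRoot hΦ hμ]

/-- A long root `γ` of greatest height is dominant, and so is the highest root `β`. Hence
`(γ, γ) ≤ (β, γ) ≤ (β, β)`. -/
lemma IsHighestRoot.isLongIn (hΦ : P.IsClosedSubsystem Φ) {β : ι} (hβ : IsHighestRoot b Φ β) :
    P.IsLongIn Φ β := by
  obtain ⟨γ, hγ, hmax⟩ := Set.exists_max_image {γ | P.IsLongIn Φ γ} b.height (Set.toFinite _)
    (exists_isLongIn ⟨β, hβ.1⟩)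
  have hdom : ∀ i ∈ Φ, b.IsPos i → 0 ≤ P.rootInner i γ := by
    intro i hi hpos
    by_contra! hlt
    have h1 := hmax _ (hγ.weylPerm_apply hΦ (reflectionPerm_mem_weylPerm hi))
    rw [b.height_add_zsmul (root_reflectionPerm_eq i γ), smul_eq_mul] at h1
    rw [rootInner_comm, ← pairingIn_neg_iff] at hlt
    rw [Base.isPos_iff] at hpos
    nlinarith
  have h1 := rootInner_le_of_sub_mem_closure hdom (hβ.2 γ hγ.1)
  have h2 := rootInner_le_of_sub_mem_closure (hβ.isMaximalRoot hΦ).rootInner_nonneg (hβ.2 γ hγ.1)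
  rw [P.rootInner_comm β γ] at h1
  exact ⟨hβ.1, fun i hi ↦ ((hγ.2 i hi).trans h1).trans h2⟩

/-! ### Irreducible components -/

lemma IsIrreducibleComponent.isClosedSubsystem {Ψ : Set ι} (hΨ : P.IsClosedSubsystem Ψ)
    (h : P.IsIrreducibleComponent Ψ Φ) : P.IsClosedSubsystem Φ :=
  hΨ.of_orthogonal_diff h.1 h.2.2

lemma IsIrreducibleSubset.subset_or_disjoint {Ψ A : Set ι} (hΦ : P.IsIrreducibleSubset Φ)
    (hΦΨ : Φ ⊆ Ψ) (horth : ∀ i ∈ A, ∀ j ∈ Ψ \ A, P.IsOrthogonal i j) : Φ ⊆ A ∨ Disjoint Φ A := by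
  rcases hΦ.2 (Φ ∩ A) (Φ \ A) (Set.inter_union_sdiff Φ A)
    (fun i hi j hj ↦ horth i hi.2 j ⟨hΦΨ hj.1, hj.2⟩) with h | h
  · exact Or.inr (Set.disjoint_iff_inter_eq_empty.2 h)
  · exact Or.inl (Set.sdiff_eq_empty.1 h)

lemma IsIrreducibleComponent.eq_of_subset {Ψ Θ : Set ι} (h : P.IsIrreducibleComponent Ψ Φ)
    (hΘ : P.IsIrreducibleSubset Θ) (hΦΘ : Φ ⊆ Θ) (hΘΨ : Θ ⊆ Ψ) : Φ = Θ := by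
  refine hΦΘ.antisymm ((hΘ.subset_or_disjoint hΘΨ h.2.2).resolve_right fun hd ↦ ?_)
  obtain ⟨i, hi⟩ := h.2.1.1
  exact Set.disjoint_left.1 hd (hΦΘ hi) hi

lemma IsIrreducibleComponent.eq_or_stronglyOrthogonal {Ψ Φ' : Set ι} (hΨ : P.IsClosedSubsystem Ψ)
    (h : P.IsIrreducibleComponent Ψ Φ) (h' : P.IsIrreducibleComponent Ψ Φ') :
    Φ = Φ' ∨ ∀ i ∈ Φ, ∀ j ∈ Φ', P.StronglyOrthogonal i j := by
  rcases h.2.1.subset_or_disjoint h.1 h'.2.2 with hs | hd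
  · exact Or.inl (h.eq_of_subset h'.2.1 hs h'.1)
  · refine Or.inr fun i hi j hj ↦ (hΨ.stronglyOrthogonal_of_orthogonal_diff h'.1 h'.2.2 hj ?_).symm
    exact ⟨h.1 hi, Set.disjoint_left.1 hd hi⟩

/-- Cardinalities may be compared on irreducible components, since these partition `Ψ`. -/
lemma ncard_inter_le_of_isIrreducibleComponent {Ψ Γ C : Set ι}
    (h : ∀ Φ, P.IsIrreducibleComponent Ψ Φ → (Γ ∩ Φ).ncard ≤ (C ∩ Φ).ncard) :
    (Γ ∩ Ψ).ncard ≤ (C ∩ Ψ).ncard := by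
  induction hn : Ψ.ncard using Nat.strong_induction_on generalizing Ψ with
  | _ n ih =>
  subst hn
  rcases Ψ.eq_empty_or_nonempty with rfl | hne
  · simp
  by_cases hirr : P.IsIrreducibleSubset Ψ
  · exact h Ψ ⟨subset_rfl, hirr, fun i _ j hj ↦ absurd hj.1 hj.2⟩
  obtain ⟨A, hA, ⟨a, ha⟩, ⟨c, hc⟩, horth⟩ := exists_orthogonal_diff hne hirr
  have h1 := ih _ (Set.ncard_lt_ncard ⟨hA, fun hs ↦ hc.2 (hs hc.1)⟩) (fun Φ hΦ ↦
    h Φ ⟨hΦ.1.trans hA, hΦ.2.1, fun i hi j hj ↦ by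
      by_cases hjA : j ∈ A
      · exact hΦ.2.2 i hi j ⟨hjA, hj.2⟩
      · exact horth i (hΦ.1 hi) j ⟨hj.1, hjA⟩⟩) rfl
  have h2 := ih _ (Set.ncard_lt_ncard ⟨Set.sdiff_subset, fun hs ↦ (hs (hA ha)).2 ha⟩) (fun Φ hΦ ↦
    h Φ ⟨hΦ.1.trans Set.sdiff_subset, hΦ.2.1, fun i hi j hj ↦ by
      by_cases hjA : j ∈ A
      · exact (horth j hjA i (hΦ.1 hi)).symm
      · exact hΦ.2.2 i hi j ⟨⟨hj.1, hjA⟩, hj.2⟩⟩) rfl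
  have hsplit (Δ : Set ι) : (Δ ∩ Ψ).ncard = (Δ ∩ A).ncard + (Δ ∩ (Ψ \ A)).ncard := by
    rw [← Set.ncard_union_eq (Set.disjoint_left.2 fun i hi hi' ↦ hi'.2.2 hi.2),
      ← Set.inter_union_distrib_left, Set.union_sdiff_cancel hA]
  rw [hsplit Γ, hsplit C]
  exact add_le_add h1 h2

/-! ### The cascade -/

lemma IsCascadeSubsystem.isClosedSubsystem_and_isIrreducibleSubset (h : IsCascadeSubsystem b Φ) :
    P.IsClosedSubsystem Φ ∧ P.IsIrreducibleSubset Φ := by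
  induction h with
  | component Φ hΦ => exact ⟨hΦ.isClosedSubsystem isClosedSubsystem_univ, hΦ.2.1⟩
  | step Φ Φ' β _ _ hΦ' ih => exact ⟨hΦ'.isClosedSubsystem (ih.1.perpIn β), hΦ'.2.1⟩

lemma IsCascadeSubsystem.isClosedSubsystem (h : IsCascadeSubsystem b Φ) :
    P.IsClosedSubsystem Φ :=
  h.isClosedSubsystem_and_isIrreducibleSubset.1

lemma IsCascadeSubsystem.isIrreducibleSubset (h : IsCascadeSubsystem b Φ) :
    P.IsIrreducibleSubset Φ :=
  h.isClosedSubsystem_and_isIrreducibleSubset.2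

lemma IsCascadeSubsystem.existsUnique_isHighestRoot (h : IsCascadeSubsystem b Φ) :
    ∃! β, IsHighestRoot b Φ β :=
  RootPairing.existsUnique_isHighestRoot h.isClosedSubsystem h.isIrreducibleSubset

/-- `Φ'` lies in the orthogonal complement of the highest root of `Φ`, inside `Φ`. -/
def IsBelow (b : P.Base) (Φ' Φ : Set ι) : Prop := ∃ β, IsHighestRoot b Φ β ∧ Φ' ⊆ P.perpIn Φ β

lemma IsBelow.ne {Φ' : Set ι} (h : IsBelow b Φ' Φ) : Φ' ≠ Φ := by
  rintro rfl
  obtain ⟨β, hβ, hsub⟩ := h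
  exact notMem_perpIn (P := P) (hsub hβ.1)

lemma IsBelow.subset {Φ' : Set ι} (h : IsBelow b Φ' Φ) : Φ' ⊆ Φ := by
  obtain ⟨β, -, hsub⟩ := h
  exact hsub.trans perpIn_subset

lemma IsBelow.mono {Φ' Φ'' : Set ι} (h : IsBelow b Φ' Φ) (hs : Φ'' ⊆ Φ') : IsBelow b Φ'' Φ := by
  obtain ⟨β, hβ, hsub⟩ := h
  exact ⟨β, hβ, hs.trans hsub⟩

/-- The possible relative positions of two subsystems of the cascade: the subsystems form a forest
whose nodes are either comparable or strongly orthogonal. -/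
def CascadeRel (b : P.Base) (Φ Φ' : Set ι) : Prop :=
  Φ = Φ' ∨ (∀ i ∈ Φ, ∀ j ∈ Φ', P.StronglyOrthogonal i j) ∨ IsBelow b Φ Φ' ∨ IsBelow b Φ' Φ

lemma CascadeRel.symm {Φ' : Set ι} (h : CascadeRel b Φ Φ') : CascadeRel b Φ' Φ := by
  rcases h with h | h | h | h
  · exact Or.inl h.symm
  · exact Or.inr (Or.inl fun i hi j hj ↦ (h j hj i hi).symm)
  · exact Or.inr (Or.inr (Or.inr h))
  · exact Or.inr (Or.inr (Or.inl h))

lemma IsCascadeSubsystem.cascadeRel_component {Φ' : Set ι}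
    (hΦ : P.IsIrreducibleComponent Set.univ Φ) (hΦ' : IsCascadeSubsystem b Φ') :
    CascadeRel b Φ Φ' := by
  induction hΦ' with
  | component Φ' hΦ' =>
    exact (hΦ.eq_or_stronglyOrthogonal isClosedSubsystem_univ hΦ').imp_right Or.inl
  | step Φ₁ Φ' β hΦ₁ hβ hΦ' ih =>
    have hlow : IsBelow b Φ' Φ₁ := ⟨β, hβ, hΦ'.1⟩
    rcases ih with rfl | h | h | h
    · exact Or.inr (Or.inr (Or.inr hlow))
    · exact Or.inr (Or.inl fun i hi j hj ↦ h i hi j (hlow.subset hj))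
    · exact absurd (hΦ.eq_of_subset hΦ₁.isIrreducibleSubset h.subset (Set.subset_univ _)) h.ne
    · exact Or.inr (Or.inr (Or.inr (h.mono hlow.subset)))

/-- No subsystem of the cascade fits strictly between `Φ₁'` and a component `Φ'` of the orthogonal
complement of its highest root. -/
lemma IsCascadeSubsystem.not_isBelow_of_isBelow {Φ₁ Φ₁' Φ' : Set ι} {β' : ι}
    (hΦ₁ : IsCascadeSubsystem b Φ₁) (hΦ₁' : IsCascadeSubsystem b Φ₁')
    (hβ' : IsHighestRoot b Φ₁' β') (hΦ' : P.IsIrreducibleComponent (P.perpIn Φ₁' β') Φ')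
    (h : IsBelow b Φ' Φ₁) : ¬ IsBelow b Φ₁ Φ₁' := by
  rintro ⟨β, hβ, hsub⟩
  obtain rfl := hΦ₁'.existsUnique_isHighestRoot.unique hβ hβ'
  exact h.ne (hΦ'.eq_of_subset hΦ₁.isIrreducibleSubset h.subset hsub)

lemma IsCascadeSubsystem.cascadeRel {Φ' : Set ι} (hΦ : IsCascadeSubsystem b Φ)
    (hΦ' : IsCascadeSubsystem b Φ') : CascadeRel b Φ Φ' := by
  induction hΦ generalizing Φ' with
  | component Φ hΦ => exact cascadeRel_component hΦ hΦ'
  | step Φ₁ Φ β hΦ₁ hβ hΦ ih =>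
    have hlow : IsBelow b Φ Φ₁ := ⟨β, hβ, hΦ.1⟩
    induction hΦ' with
    | component Φ' hΦ' => exact (cascadeRel_component hΦ' (.step Φ₁ Φ β hΦ₁ hβ hΦ)).symm
    | step Φ₁' Φ' β' hΦ₁' hβ' hΦ' ih' =>
      have hlow' : IsBelow b Φ' Φ₁' := ⟨β', hβ', hΦ'.1⟩
      rcases ih (.step Φ₁' Φ' β' hΦ₁' hβ' hΦ') with rfl | h | h | hb
      · exact Or.inr (Or.inr (Or.inl hlow))
      · exact Or.inr (Or.inl fun i hi j hj ↦ h i (hlow.subset hi) j hj)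
      · exact Or.inr (Or.inr (Or.inl (h.mono hlow.subset)))
      rcases ih' with rfl | h | hb' | h
      · exact Or.inr (Or.inr (Or.inr hlow'))
      · exact Or.inr (Or.inl fun i hi j hj ↦ h i hi j (hlow'.subset hj))
      -- now `Φ` and `Φ'` are both below `Φ₁` and below `Φ₁'`, so that these two are equal unless
      -- they are strongly orthogonal
      · rcases ih hΦ₁' with rfl | h | h | h
        · obtain rfl := hΦ₁.existsUnique_isHighestRoot.unique hβ hβ'
          exact (hΦ.eq_or_stronglyOrthogonal (hΦ₁.isClosedSubsystem.perpIn β) hΦ').imp_right Or.inl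
        · exact Or.inr (Or.inl fun i hi j hj ↦ h i (hlow.subset hi) j (hlow'.subset hj))
        · exact absurd h (hΦ₁.not_isBelow_of_isBelow hΦ₁' hβ' hΦ' hb)
        · exact absurd h (hΦ₁'.not_isBelow_of_isBelow hΦ₁ hβ hΦ hb')
      · exact Or.inr (Or.inr (Or.inr (h.mono hlow'.subset)))

lemma IsCascadeSubsystem.eq_of_isHighestRoot {Φ' : Set ι} {β : ι} (hΦ : IsCascadeSubsystem b Φ)
    (hΦ' : IsCascadeSubsystem b Φ') (hβ : IsHighestRoot b Φ β) (hβ' : IsHighestRoot b Φ' β) :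
    Φ = Φ' := by
  rcases hΦ.cascadeRel hΦ' with h | h | ⟨γ, hγ, hsub⟩ | ⟨γ, hγ, hsub⟩
  · exact h
  · exact absurd rfl (h β hβ.1 β hβ'.1).ne
  · obtain rfl := hΦ'.existsUnique_isHighestRoot.unique hγ hβ'
    exact absurd (hsub hβ.1) notMem_perpIn
  · obtain rfl := hΦ.existsUnique_isHighestRoot.unique hγ hβ
    exact absurd (hsub hβ'.1) notMem_perpIn

lemma isStronglyOrthogonalSet_cascadeRoots (b : P.Base) :
    P.IsStronglyOrthogonalSet (cascadeRoots b) := by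
  rintro β ⟨Φ, hΦ, hβ⟩ β' ⟨Φ', hΦ', hβ'⟩ hne
  rcases hΦ.cascadeRel hΦ' with rfl | h | ⟨γ, hγ, hsub⟩ | ⟨γ, hγ, hsub⟩
  · exact absurd (hΦ.existsUnique_isHighestRoot.unique hβ hβ') hne
  · exact h β hβ.1 β' hβ'.1
  · obtain rfl := hΦ'.existsUnique_isHighestRoot.unique hγ hβ'
    exact (hγ.isLongIn hΦ'.isClosedSubsystem).stronglyOrthogonal hΦ'.isClosedSubsystem (hsub hβ.1)
  · obtain rfl := hΦ.existsUnique_isHighestRoot.unique hγ hβ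
    exact ((hγ.isLongIn hΦ.isClosedSubsystem).stronglyOrthogonal hΦ.isClosedSubsystem
      (hsub hβ'.1)).symm

/-- A maximum strongly orthogonal subset of `Φ` may be moved so as to contain the highest root `β`
of `Φ`; the rest of it is orthogonal to `β` and is compared with the cascade on the irreducible
components of the orthogonal complement of `β`. -/
lemma IsCascadeSubsystem.ncard_inter_le {Γ : Set ι} (hΦ : IsCascadeSubsystem b Φ)
    (hΓ : P.IsStronglyOrthogonalSet Γ) : (Γ ∩ Φ).ncard ≤ (cascadeRoots b ∩ Φ).ncard := by
  induction hn : Φ.ncard using Nat.strong_induction_on generalizing Φ Γ with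
  | _ n ih =>
  subst hn
  have hcl := hΦ.isClosedSubsystem
  obtain ⟨β, hβ, -⟩ := hΦ.existsUnique_isHighestRoot
  have hlong := hβ.isLongIn hcl
  obtain ⟨Γ₀, hΓ₀⟩ := exists_isMaximumIn (P := P) Φ
  obtain ⟨g, hg, hgβ⟩ := hΓ₀.exists_weylPerm_mem_image hcl hΦ.isIrreducibleSubset hlong
  have hΓ₁ := hΓ₀.image hcl hg
  generalize g '' Γ₀ = Γ₁ at *
  have hperp := hΓ₁.diff_singleton hcl hlong hgβ
  have h1 := hΓ₁.2.2 (Γ ∩ Φ) Set.inter_subset_right (hΓ.mono Set.inter_subset_left)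
  have h2 : ((Γ₁ \ {β}) ∩ P.perpIn Φ β).ncard ≤ (cascadeRoots b ∩ P.perpIn Φ β).ncard :=
    ncard_inter_le_of_isIrreducibleComponent fun Φ' hΦ' ↦ by
      refine ih _ (Set.ncard_lt_ncard ⟨hΦ'.1.trans perpIn_subset, fun hs ↦ ?_⟩)
        (.step Φ Φ' β hΦ hβ hΦ') hperp.2.1 rfl
      exact notMem_perpIn (P := P) (hΦ'.1 (hs hβ.1))
  rw [Set.inter_eq_left.2 hperp.1] at h2
  have h3 : (insert β (cascadeRoots b ∩ P.perpIn Φ β)).ncard ≤ (cascadeRoots b ∩ Φ).ncard :=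
    Set.ncard_le_ncard (Set.insert_subset ⟨⟨Φ, hΦ, hβ⟩, hβ.1⟩
      (Set.inter_subset_inter_right _ perpIn_subset))
  rw [Set.ncard_insert_of_notMem fun h ↦ notMem_perpIn h.2] at h3
  have h4 := Set.ncard_sdiff_singleton_add_one hgβ
  omega

theorem isMaximumStronglyOrthogonalSet_cascadeRoots (b : P.Base) :
    P.IsMaximumStronglyOrthogonalSet (cascadeRoots b) := by
  refine ⟨isStronglyOrthogonalSet_cascadeRoots b, fun Γ hΓ ↦ ?_⟩
  have := ncard_inter_le_of_isIrreducibleComponent (P := P) (Ψ := Set.univ) (Γ := Γ)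
    (C := cascadeRoots b) fun Φ hΦ ↦ (IsCascadeSubsystem.component Φ hΦ).ncard_inter_le hΓ
  rw [Set.inter_univ, Set.inter_univ] at this
  rw [← (Set.toFinite Γ).cast_ncard_eq, ← (Set.toFinite (cascadeRoots b)).cast_ncard_eq]
  exact_mod_cast this

lemma IsMaximumStronglyOrthogonalSet.isMaximumIn {Γ : Set ι}
    (h : P.IsMaximumStronglyOrthogonalSet Γ) : P.IsMaximumIn Set.univ Γ := by
  refine ⟨Set.subset_univ _, h.1, fun Γ' _ hΓ' ↦ ?_⟩
  have := h.2 Γ' hΓ'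
  rw [← (Set.toFinite Γ).cast_ncard_eq, ← (Set.toFinite Γ').cast_ncard_eq] at this
  exact_mod_cast this

theorem IsMaximumStronglyOrthogonalSet.exists_weylGroup_image_eq {Γ Γ' : Set ι}
    (h : P.IsMaximumStronglyOrthogonalSet Γ) (h' : P.IsMaximumStronglyOrthogonalSet Γ') :
    ∃ w : P.weylGroup, P.weylGroupToPerm w '' Γ = Γ' := by
  obtain ⟨g, hg, hgΓ⟩ :=
    h.isMaximumIn.exists_weylPerm_image_eq isClosedSubsystem_univ h'.isMaximumIn
  rw [weylPerm, Set.image_univ, ← range_weylGroupToPerm] at hg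
  obtain ⟨w, rfl⟩ := hg
  exact ⟨w, hgΓ⟩

end Reduced

end RootPairing

theorem mainTheorem6 {K L : Type*} [Field K] [CharZero K] [LieRing L] [LieAlgebra K L]
    [FiniteDimensional K L] [LieAlgebra.IsSemisimple K L]
    (H : LieSubalgebra K L) [H.IsCartanSubalgebra] [LieModule.IsTriangularizable K H L] :
    (∀ b : (LieAlgebra.IsKilling.rootSystem H).Base,
      (∀ Φ : Set H.root, RootPairing.IsCascadeSubsystem b Φ →
        ∃! β : H.root, RootPairing.IsHighestRoot b Φ β) ∧
      (∀ (Φ Φ' : Set H.root) (β : H.root),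
        RootPairing.IsCascadeSubsystem b Φ → RootPairing.IsCascadeSubsystem b Φ' →
        RootPairing.IsHighestRoot b Φ β → RootPairing.IsHighestRoot b Φ' β → Φ = Φ') ∧
      (LieAlgebra.IsKilling.rootSystem H).IsMaximumStronglyOrthogonalSet
        (RootPairing.cascadeRoots b)) ∧
    (∀ Γ Γ' : Set H.root,
      (LieAlgebra.IsKilling.rootSystem H).IsMaximumStronglyOrthogonalSet Γ →
      (LieAlgebra.IsKilling.rootSystem H).IsMaximumStronglyOrthogonalSet Γ' →
      ∃ w : (LieAlgebra.IsKilling.rootSystem H).weylGroup,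
        (LieAlgebra.IsKilling.rootSystem H).weylGroupToPerm w '' Γ = Γ') :=
  ⟨fun b ↦ ⟨fun _ hΦ ↦ hΦ.existsUnique_isHighestRoot,
    fun _ _ _ hΦ hΦ' hβ hβ' ↦ hΦ.eq_of_isHighestRoot hΦ' hβ hβ',
    RootPairing.isMaximumStronglyOrthogonalSet_cascadeRoots b⟩,
    fun _ _ h h' ↦ h.exists_weylGroup_image_eq h'⟩
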